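/- **Setting.** Let $\triangle^D=\{q\in\mathbb R^D: q\ge 0,\ \sum_i q_i=1\}$. Let $\Omega$ be a convex regularizer, i.e. for every $D$ a real-valued function $\Omega=\Omega_D$ that is convex on $\triangle^D$ (in particular it may be strongly convex). The max operator smoothed by $\Omega$ is $\max_\Omega(x)=\sup_{q\in\triangle^D}\langle q,x\rangle-\Omega(q)$ for $x\in(\mathbb R\cup\{-\infty\})^D$ with at least one finite coordinate, where $x_j=-\infty$ forces $q_j=0$ (with $0\cdot(-\infty)=0$). Let $G$ be a finite directed acyclic graph with $N\ge 2$ nodes numbered $1,\dots,N$ in topological order, in which node $1$ is the only node without parents and node $N$ the only node without children. Let $\mathcal P_i$ be the set of parents of node $i$, let $\theta_{i,j}\in\mathbb R$ be the weight of the edge from the parent $j\in\mathcal P_i$ to the child $i$, and put $\theta_{i,j}=-\infty$ if $j\notin\mathcal P_i$. Let $\mathcal Y$ be the finite set of all paths from node $1$ to node $N$, and let $\langle Y,\theta\rangle$ denote the sum of the weights of the edges of $Y\in\mathcal Y$. Define $$\mathrm{LP}(\theta)=\max_{Y\in\mathcal Y}\langle Y,\theta\rangle,\qquad \mathrm{LP}_\Omega(\theta)=\max\nolimits_\Omega\big((\langle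 Y,\theta\rangle)_{Y\in\mathcal Y}\big),$$ the latter with $\Omega=\Omega_{|\mathcal Y|}$, and $\mathrm{DP}_\Omega(\theta)=v_N(\theta)$, where $$v_1(\theta)=0,\qquad v_i(\theta)=\max\nolimits_\Omega\big((\theta_{i,j}+v_j(\theta))_{j\in\mathcal P_i}\big)\quad(2\le i\le N),$$ where in the recursion $\Omega=\Omega_N$ and the coordinates $j\notin\mathcal P_i$ of the vector in $(\mathbb R\cup\{-\infty\})^N$ are $-\infty$. **Proposition (Properties of $\mathrm{DP}_\Omega$).** 1. For every such $G$, $\mathrm{DP}_\Omega(\theta)$ is a convex function of $\theta$. 2. For every such $G$, if $L_{\Omega,N}\le\Omega(q)\le U_{\Omega,N}$ for all $q\in\triangle^N$, then for all $\theta$ $$\min\{L_{\Omega,N},(N-1)L_{\Omega,N}\}\ \le\ \mathrm{LP}(\theta)-\mathrm{DP}_\Omega(\theta)\ \le\ \max\{U_{\Omega,N},(N-1)U_{\Omega,N}\}.$$ In particular, if $L_{\Omega,N}\le 0\le U_{\Omega,N}$, then $(N-1)L_{\Omega,N}\le\mathrm{LP}(\theta)-\mathrm{DP}_\Omega(\theta)\le(N-1)U_{\Omega,N}$.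 3. Suppose moreover that $\Omega$ is lower semicontinuous on $\triangle^D$ for every $D$, and separable: there is one function $\omega$ such that $\Omega(q)=\sum_{i=1}^D\omega(q_i)$ for all $D$ and all $q\in\triangle^D$. Then $\mathrm{DP}_\Omega(\theta)=\mathrm{LP}_\Omega(\theta)$ for all such graphs $G$ and all weights $\theta$ **if and only if** there is a $\gamma\ge 0$ with $\Omega=-\gamma H$, i.e. $\Omega(q)=\gamma\sum_{i=1}^D q_i\log q_i$ for all $D$ and all $q\in\triangle^D$ (with $0\log 0=0$). -/

import Mathlib

noncomputable section

/-- A finite directed acyclic graph whose `N ≥ 2` nodes are numbered in topological order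
(`Fin N`, the labels being `0, …, N - 1`).  There is an edge from the
parent `j` to the child `i` exactly when `j ∈ parents i`.  The first node is the only node without
parents and the last node is the only node without children. -/
structure TopoDAG (N : ℕ) where
  parents : Fin N → Finset (Fin N)
  two_le : 2 ≤ N
  parent_lt : ∀ i j, j ∈ parents i → j < i
  parents_eq_empty_iff : ∀ i, parents i = ∅ ↔ (i : ℕ) = 0
  no_child_iff : ∀ j, (∀ i, j ∉ parents i) ↔ (j : ℕ) + 1 = N

namespace TopoDAG

variable {N : ℕ}

/-- The start node. -/
def source (G : TopoDAG N) : Fin N := ⟨0, by have := G.two_le; omega⟩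

/-- The end node. -/
def sink (G : TopoDAG N) : Fin N := ⟨N - 1, by have := G.two_le; omega⟩

/-- A path from the start node to the end node, as the list of the nodes it visits. -/
def IsPath (G : TopoDAG N) (l : List (Fin N)) : Prop :=
  l.head? = some G.source ∧ l.getLast? = some G.sink ∧
    l.IsChain (fun j i => j ∈ G.parents i)

theorem finite_isPath (G : TopoDAG N) : {l : List (Fin N) | G.IsPath l}.Finite := by
  refine (List.finite_length_le (Fin N) N).subset ?_
  rintro l ⟨-, -, hl⟩
  have h1 : l.IsChain (· < ·) := hl.imp (fun a b h => G.parent_lt b a h)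
  have h2 : l.Nodup := (List.isChain_iff_pairwise.mp h1).imp (fun h => ne_of_lt h)
  simpa using h2.length_le_card

/-- The finite set of all paths from the start node to the end node. -/
def paths (G : TopoDAG N) : Finset (List (Fin N)) := G.finite_isPath.toFinset

end TopoDAG

/-- The score of a path: the sum of the weights of its edges, `θ i j` being the weight of the edge
from the parent `j` to the child `i`. -/
def pathScore {N : ℕ} (θ : Matrix (Fin N) (Fin N) ℝ) : List (Fin N) → ℝ
  | [] => 0
  | [_] => 0
  | j :: i :: l => θ i j + pathScore θ (i :: l)

/-- The max operator smoothed by `Ω`, at the vector that agrees with `x` on `s` and is `-∞` outside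
`s`: a coordinate equal to `-∞` forces the corresponding weight `q j` to vanish. -/
def smoothMaxOn {D : ℕ} (Ω : (Fin D → ℝ) → ℝ) (s : Finset (Fin D)) (x : Fin D → ℝ) : ℝ :=
  sSup ((fun q : Fin D → ℝ => ∑ j, q j * x j - Ω q) ''
    {q | q ∈ stdSimplex ℝ (Fin D) ∧ ∀ j, j ∉ s → q j = 0})

/-- The max operator smoothed by `Ω`, on `ℝ ^ D`. -/
def smoothMax {D : ℕ} (Ω : (Fin D → ℝ) → ℝ) (x : Fin D → ℝ) : ℝ :=
  smoothMaxOn Ω Finset.univ x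

namespace TopoDAG

variable {N : ℕ}

/-- The smoothed Bellman recursion: `0` at the start node and, at every other node `i`, the
smoothed max of `θ i j + v j` over the parents `j` of `i`. -/
def smoothValue (G : TopoDAG N) (Ω : (Fin N → ℝ) → ℝ) (θ : Matrix (Fin N) (Fin N) ℝ)
    (i : Fin N) : ℝ :=
  if (i : ℕ) = 0 then 0
  else smoothMaxOn Ω (G.parents i)
    (fun j => if _h : j ∈ G.parents i then θ i j + smoothValue G Ω θ j else 0)
termination_by (i : ℕ)
decreasing_by exact G.parent_lt i j _h

/-- The smoothed dynamic program. -/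
def smoothDP (G : TopoDAG N) (Ω : (Fin N → ℝ) → ℝ) (θ : Matrix (Fin N) (Fin N) ℝ) : ℝ :=
  G.smoothValue Ω θ G.sink

/-- The highest score among all paths. -/
def LP (G : TopoDAG N) (θ : Matrix (Fin N) (Fin N) ℝ) : ℝ :=
  ⨆ Y : G.paths, pathScore θ (Y : List (Fin N))

/-- The globally smoothed maximum of the scores of all paths.  The coordinates of
`ℝ ^ (number of paths)` are the paths in some enumeration; it is irrelevant when `Ω` is
invariant under permutations of the coordinates. -/
def smoothLP (G : TopoDAG N) (Ω : (D : ℕ) → (Fin D → ℝ) → ℝ)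
    (θ : Matrix (Fin N) (Fin N) ℝ) : ℝ :=
  smoothMax (Ω G.paths.card)
    (fun k => pathScore θ (G.paths.equivFin.symm k : List (Fin N)))

end TopoDAG

/-- `Ω` is a sum over the coordinates of one and the same function `ω`. -/
def IsSeparableRegularizer (Ω : (D : ℕ) → (Fin D → ℝ) → ℝ) : Prop :=
  ∃ ω : ℝ → ℝ, ∀ D, ∀ q ∈ stdSimplex ℝ (Fin D), Ω D q = ∑ i, ω (q i)

/-- Shannon entropy `- ∑ i, q i * log (q i)`, with `0 * log 0 = 0`. -/
def shannonEntropy {D : ℕ} (q : Fin D → ℝ) : ℝ := ∑ i, Real.negMulLog (q i)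

end

/-!
Convexity of the smoothed dynamic program and its distance to the longest path follow by induction
along the topological order: the smoothed max is monotone and jointly convex in its argument
(`smoothMaxOn_le_convexCombo`), and it differs from the max by a value of the regularizer at each of
the at most `N - 1` edges of a path. The suprema are finite because a convex function on the simplex
is bounded below (`ConvexOn.exists_forall_le_stdSimplex`).

For `Ω = -γ H` with `γ > 0` the smoothed max is `γ` times the log-sum-exp of the argument divided by
`γ` (Gibbs variational principle), so the Bellman recursion sums `exp (score / γ)` over all paths;
for `γ = 0` both programs are the maximum over all paths.

Conversely, let the two programs agree. A single edge and a path with two edges give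
`ω 0 = ω 1 = 0`. The graph `nestedChoice` gives
`max_Ω (a, b, c) = max_Ω (a, max_Ω (b, c))`. Since a lower semicontinuous convex `Ω` is the conjugate
of its smoothed max, this turns into the grouping rule
`ω (s r) + ω (s (1 - r)) = ω s + s (ω r + ω (1 - r))` (`grouping_of_smoothMax_assoc`).
By the grouping rule `n ↦ n ω (1 / n)` is completely additive, and by convexity of `Ω` it is
antitone, so it is `-γ log n` with `γ ≥ 0`. This determines `ω p + ω (1 - p)` at the rationals, and
by continuity of convex functions on the open interval everywhere. Finally the grouping rule reduces
`∑ i, ω (q i)` to these binary values. The function `ω` itself is not determined: it may differ from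
`γ x log x` by an additive function vanishing at `1`, which cancels in the sum.
-/

/-! ### The smoothed max operator -/

/-- A real-valued convex function on the simplex is bounded below, without any continuity: the
barycenter lies strictly between any point and another point of the simplex, and the function is
bounded above by its values at the vertices. -/
lemma ConvexOn.exists_forall_le_stdSimplex {D : ℕ} {Ω : (Fin D → ℝ) → ℝ}
    (h : ConvexOn ℝ (stdSimplex ℝ (Fin D)) Ω) : ∃ m, ∀ q ∈ stdSimplex ℝ (Fin D), m ≤ Ω q := by
  rcases Nat.eq_zero_or_pos D with rfl | hD
  · exact ⟨0, fun q hq => by simpa using hq.2⟩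
  have hD' : (0 : ℝ) < D := by exact_mod_cast hD
  set M : ℝ := ∑ i, |Ω (Pi.single i 1)| with hM
  have hub : ∀ q ∈ stdSimplex ℝ (Fin D), Ω q ≤ M := by
    intro q hq
    have hJ := h.map_sum_le (t := Finset.univ) (w := q) (p := fun i => Pi.single i (1 : ℝ))
      (fun i _ => hq.1 i) hq.2 (fun i _ => single_mem_stdSimplex ℝ i)
    have hq' : ∑ i, q i • (Pi.single i (1 : ℝ) : Fin D → ℝ) = q := by
      ext j
      simp [Finset.sum_apply, Pi.single_apply]
    rw [hq'] at hJ
    refine hJ.trans (Finset.sum_le_sum fun i _ => ?_)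
    rw [smul_eq_mul]
    calc q i * Ω (Pi.single i 1) ≤ q i * |Ω (Pi.single i 1)| :=
          mul_le_mul_of_nonneg_left (le_abs_self _) (hq.1 i)
      _ ≤ 1 * |Ω (Pi.single i 1)| :=
          mul_le_mul_of_nonneg_right (mem_Icc_of_mem_stdSimplex hq i).2 (abs_nonneg _)
      _ = _ := one_mul _
  set c : Fin D → ℝ := fun _ => 1 / (D : ℝ) with hc
  set t : ℝ := 1 / ((D : ℝ) + 1) with ht
  have ht0 : 0 < t := by positivity
  have ht1 : 0 < 1 - t := by
    rw [ht, sub_pos, div_lt_one (by positivity)]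
    linarith
  have htD : t ≤ 1 / (D : ℝ) := one_div_le_one_div_of_le hD' (by linarith)
  refine ⟨(Ω c - (1 - t) * M) / t, fun q hq => ?_⟩
  set q' : Fin D → ℝ := fun i => (c i - t * q i) / (1 - t) with hq'
  have hq'mem : q' ∈ stdSimplex ℝ (Fin D) := by
    refine ⟨fun i => div_nonneg (sub_nonneg.2 ?_) ht1.le, ?_⟩
    · calc t * q i ≤ t * 1 :=
            mul_le_mul_of_nonneg_left (mem_Icc_of_mem_stdSimplex hq i).2 ht0.le
        _ ≤ c i := by rw [mul_one]; exact htD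
    · rw [← Finset.sum_div, Finset.sum_sub_distrib, ← Finset.mul_sum, hq.2]
      simp only [hc, Finset.sum_const, Finset.card_univ, Fintype.card_fin, nsmul_eq_mul]
      field_simp
  have hcomb : t • q + (1 - t) • q' = c := by
    ext i
    simp only [hq', Pi.add_apply, Pi.smul_apply, smul_eq_mul]
    field_simp
    ring
  have h1 := h.2 hq hq'mem ht0.le ht1.le (by ring)
  rw [hcomb, smul_eq_mul, smul_eq_mul] at h1
  have h2 := mul_le_mul_of_nonneg_left (hub q' hq'mem) ht1.le
  rw [div_le_iff₀ ht0]
  linarith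

section SmoothMax

variable {D : ℕ} {Ω : (Fin D → ℝ) → ℝ} {s : Finset (Fin D)}

lemma single_mem_face {j : Fin D} (hj : j ∈ s) :
    (Pi.single j 1 : Fin D → ℝ) ∈ stdSimplex ℝ (Fin D) ∧
      ∀ k, k ∉ s → (Pi.single j 1 : Fin D → ℝ) k = 0 :=
  ⟨single_mem_stdSimplex ℝ j, fun k hk => by
    rw [Pi.single_eq_of_ne]
    rintro rfl
    exact hk hj⟩

lemma le_smoothMaxOn {m : ℝ} (hm : ∀ q ∈ stdSimplex ℝ (Fin D), m ≤ Ω q) (x : Fin D → ℝ)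
    {q : Fin D → ℝ} (hq : q ∈ stdSimplex ℝ (Fin D)) (hqs : ∀ j, j ∉ s → q j = 0) :
    ∑ j, q j * x j - Ω q ≤ smoothMaxOn Ω s x := by
  refine le_csSup ⟨∑ j, |x j| - m, ?_⟩ ⟨q, ⟨hq, hqs⟩, rfl⟩
  rintro _ ⟨p, ⟨hp, -⟩, rfl⟩
  refine sub_le_sub (Finset.sum_le_sum fun j _ => ?_) (hm p hp)
  calc p j * x j ≤ p j * |x j| := mul_le_mul_of_nonneg_left (le_abs_self _) (hp.1 j)
    _ ≤ 1 * |x j| :=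
        mul_le_mul_of_nonneg_right (mem_Icc_of_mem_stdSimplex hp j).2 (abs_nonneg _)
    _ = _ := one_mul _

lemma smoothMaxOn_le (hs : s.Nonempty) {x : Fin D → ℝ} {K : ℝ}
    (h : ∀ q ∈ stdSimplex ℝ (Fin D), (∀ j, j ∉ s → q j = 0) → ∑ j, q j * x j - Ω q ≤ K) :
    smoothMaxOn Ω s x ≤ K := by
  obtain ⟨j, hj⟩ := hs
  refine csSup_le ⟨_, _, single_mem_face hj, rfl⟩ ?_
  rintro _ ⟨p, ⟨hp, hps⟩, rfl⟩
  exact h p hp hps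

lemma smoothMaxOn_congr {x y : Fin D → ℝ} (h : ∀ j ∈ s, x j = y j) :
    smoothMaxOn Ω s x = smoothMaxOn Ω s y := by
  unfold smoothMaxOn
  congr 1
  refine Set.image_congr fun q hq => ?_
  congr 1
  refine Finset.sum_congr rfl fun j _ => ?_
  by_cases hj : j ∈ s
  · rw [h j hj]
  · rw [hq.2 j hj, zero_mul, zero_mul]

lemma sub_le_smoothMaxOn {m : ℝ} (hm : ∀ q ∈ stdSimplex ℝ (Fin D), m ≤ Ω q) (x : Fin D → ℝ)
    {j : Fin D} (hj : j ∈ s) : x j - Ω (Pi.single j 1) ≤ smoothMaxOn Ω s x := by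
  have h := le_smoothMaxOn hm x (single_mem_face hj).1 (single_mem_face hj).2
  simpa [Pi.single_apply] using h

lemma sum_mul_le_of_forall_le {q x : Fin D → ℝ} {K : ℝ} (hq : q ∈ stdSimplex ℝ (Fin D))
    (hqs : ∀ j, j ∉ s → q j = 0) (hx : ∀ j ∈ s, x j ≤ K) : ∑ j, q j * x j ≤ K := by
  calc ∑ j, q j * x j ≤ ∑ j, q j * K := Finset.sum_le_sum fun j _ => by
        by_cases hj : j ∈ s
        · exact mul_le_mul_of_nonneg_left (hx j hj) (hq.1 j)
        · rw [hqs j hj, zero_mul, zero_mul]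
    _ = K := by rw [← Finset.sum_mul, hq.2, one_mul]

lemma smoothMaxOn_le_sub {m K : ℝ} (hs : s.Nonempty)
    (hm : ∀ q ∈ stdSimplex ℝ (Fin D), m ≤ Ω q) {x : Fin D → ℝ} (hx : ∀ j ∈ s, x j ≤ K) :
    smoothMaxOn Ω s x ≤ K - m :=
  smoothMaxOn_le hs fun q hq hqs => sub_le_sub (sum_mul_le_of_forall_le hq hqs hx) (hm q hq)

lemma smoothMaxOn_singleton (j : Fin D) (x : Fin D → ℝ) :
    smoothMaxOn Ω {j} x = x j - Ω (Pi.single j 1) := by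
  have hface : {q | q ∈ stdSimplex ℝ (Fin D) ∧ ∀ k, k ∉ ({j} : Finset (Fin D)) → q k = 0} =
      {Pi.single j 1} := by
    ext q
    constructor
    · rintro ⟨hq, hqs⟩
      have hz : ∀ k, k ≠ j → q k = 0 := fun k hk => hqs k (by simpa using hk)
      have h1 : q j = 1 := by
        rw [← hq.2, Finset.sum_eq_single j (fun k _ hk => hz k hk) (by simp)]
      ext k
      by_cases hk : k = j
      · subst hk; simp [h1]
      · simp [hz k hk, hk]
    · rintro rfl
      exact single_mem_face (Finset.mem_singleton_self j)
  rw [smoothMaxOn, hface, Set.image_singleton, csSup_singleton]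
  simp [Pi.single_apply]

/-- Joint monotonicity and convexity of the smoothed max. -/
lemma smoothMaxOn_le_convexCombo {m : ℝ} (hs : s.Nonempty)
    (hm : ∀ q ∈ stdSimplex ℝ (Fin D), m ≤ Ω q) {x y z : Fin D → ℝ} {a b : ℝ} (ha : 0 ≤ a)
    (hb : 0 ≤ b) (hab : a + b = 1) (h : ∀ j ∈ s, z j ≤ a * x j + b * y j) :
    smoothMaxOn Ω s z ≤ a * smoothMaxOn Ω s x + b * smoothMaxOn Ω s y := by
  refine smoothMaxOn_le hs fun q hq hqs => ?_
  have h1 := mul_le_mul_of_nonneg_left (le_smoothMaxOn hm x hq hqs) ha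
  have h2 := mul_le_mul_of_nonneg_left (le_smoothMaxOn hm y hq hqs) hb
  have h3 : ∑ j, q j * z j ≤ a * ∑ j, q j * x j + b * ∑ j, q j * y j := by
    rw [Finset.mul_sum, Finset.mul_sum, ← Finset.sum_add_distrib]
    refine Finset.sum_le_sum fun j _ => ?_
    by_cases hj : j ∈ s
    · calc q j * z j ≤ q j * (a * x j + b * y j) := mul_le_mul_of_nonneg_left (h j hj) (hq.1 j)
        _ = _ := by ring
    · simp [hqs j hj]
  have h4 : a * Ω q + b * Ω q = Ω q := by rw [← add_mul, hab, one_mul]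
  linarith

end SmoothMax

/-! ### Paths of the graph and the Bellman recursion -/

lemma pathScore_append_singleton {N : ℕ} (θ : Matrix (Fin N) (Fin N) ℝ) (i j : Fin N) :
    ∀ l : List (Fin N), l.getLast? = some j →
      pathScore θ (l ++ [i]) = pathScore θ l + θ i j
  | [], h => by simp at h
  | [k], h => by
    obtain rfl : k = j := by simpa using h
    simp [pathScore]
  | k :: k' :: l, h => by
    have ih := pathScore_append_singleton θ i j (k' :: l) (by simpa using h)
    simp only [List.cons_append] at ih
    simp only [List.cons_append, pathScore, ih]
    ring

namespace TopoDAG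

variable {N : ℕ} (G : TopoDAG N)

lemma parents_nonempty {i : Fin N} (hi : (i : ℕ) ≠ 0) : (G.parents i).Nonempty := by
  rw [Finset.nonempty_iff_ne_empty, Ne, G.parents_eq_empty_iff]
  exact hi

lemma ne_zero_of_mem_parents {i j : Fin N} (h : j ∈ G.parents i) : (i : ℕ) ≠ 0 := by
  rw [Ne, ← G.parents_eq_empty_iff]
  exact Finset.ne_empty_of_mem h

lemma smoothValue_of_eq_zero (Ω : (Fin N → ℝ) → ℝ) (θ : Matrix (Fin N) (Fin N) ℝ) {i : Fin N}
    (hi : (i : ℕ) = 0) : G.smoothValue Ω θ i = 0 := by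
  rw [smoothValue, if_pos hi]

lemma smoothValue_of_ne_zero (Ω : (Fin N → ℝ) → ℝ) (θ : Matrix (Fin N) (Fin N) ℝ) {i : Fin N}
    (hi : (i : ℕ) ≠ 0) : G.smoothValue Ω θ i =
      smoothMaxOn Ω (G.parents i) (fun j => θ i j + G.smoothValue Ω θ j) := by
  rw [smoothValue, if_neg hi]
  exact smoothMaxOn_congr fun j hj => by rw [dif_pos hj]

lemma sink_ne_zero : ((G.sink : Fin N) : ℕ) ≠ 0 := by
  have := G.two_le
  simp only [sink]
  omega

/-- Induction along the topological order. -/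
lemma induction_on_parents {P : Fin N → Prop} (h0 : ∀ i : Fin N, (i : ℕ) = 0 → P i)
    (h1 : ∀ i : Fin N, (i : ℕ) ≠ 0 → (∀ j ∈ G.parents i, P j) → P i) (i : Fin N) : P i := by
  induction i using WellFoundedLT.induction with
  | ind i ih =>
    by_cases hi : (i : ℕ) = 0
    · exact h0 i hi
    · exact h1 i hi fun j hj => ih j (G.parent_lt i j hj)

/-- The paths from the start node to the node `i`, by recursion on their last edge. -/
def pathsTo (i : Fin N) : Finset (List (Fin N)) :=
  if (i : ℕ) = 0 then {[i]}
  else (G.parents i).attach.biUnion fun j => (pathsTo j.1).image (· ++ [i])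
termination_by (i : ℕ)
decreasing_by exact G.parent_lt i j.1 j.2

lemma pathsTo_of_eq_zero {i : Fin N} (hi : (i : ℕ) = 0) : G.pathsTo i = {[i]} := by
  rw [pathsTo, if_pos hi]

lemma pathsTo_of_ne_zero {i : Fin N} (hi : (i : ℕ) ≠ 0) :
    G.pathsTo i = (G.parents i).biUnion fun j => (G.pathsTo j).image (· ++ [i]) := by
  rw [pathsTo, if_neg hi]
  ext l
  simp

lemma mem_pathsTo (i : Fin N) : ∀ l : List (Fin N), l ∈ G.pathsTo i ↔
    l.head? = some G.source ∧ l.getLast? = some i ∧ l.IsChain (fun j i => j ∈ G.parents i) := by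
  induction i using G.induction_on_parents with
  | h0 i hi =>
    intro l
    have his : i = G.source := Fin.ext hi
    rw [G.pathsTo_of_eq_zero hi, Finset.mem_singleton]
    constructor
    · rintro rfl
      simp [his]
    · rintro ⟨hh, hl, hc⟩
      obtain ⟨l', rfl⟩ := List.getLast?_eq_some_iff.1 hl
      rcases List.eq_nil_or_concat l' with rfl | ⟨l'', j, rfl⟩
      · rfl
      · rw [List.isChain_append] at hc
        exact absurd hi (G.ne_zero_of_mem_parents (hc.2.2 j (by simp) i (by simp)))
  | h1 i hi ih =>
    intro l
    rw [G.pathsTo_of_ne_zero hi]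
    simp only [Finset.mem_biUnion, Finset.mem_image]
    constructor
    · rintro ⟨j, hj, l', hl', rfl⟩
      obtain ⟨hh, hl, hc⟩ := (ih j hj l').1 hl'
      refine ⟨by simp [List.head?_append, hh], by simp, ?_⟩
      rw [List.isChain_append]
      refine ⟨hc, by simp, ?_⟩
      intro x hx y hy
      obtain rfl : j = x := by simpa [hl] using hx
      obtain rfl : i = y := by simpa using hy
      exact hj
    · rintro ⟨hh, hl, hc⟩
      obtain ⟨l', rfl⟩ := List.getLast?_eq_some_iff.1 hl
      rcases List.eq_nil_or_concat l' with rfl | ⟨l'', j, rfl⟩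
      · obtain rfl : i = G.source := by simpa using hh
        exact absurd rfl hi
      · rw [List.isChain_append] at hc
        have hj : j ∈ G.parents i := hc.2.2 j (by simp) i (by simp)
        refine ⟨j, hj, _, (ih j hj _).2 ⟨?_, by simp, hc.1⟩, rfl⟩
        simpa [List.head?_append] using hh

lemma paths_eq_pathsTo_sink : G.paths = G.pathsTo G.sink := by
  ext l
  rw [mem_pathsTo, paths, Set.Finite.mem_toFinset]
  rfl

lemma pathsTo_nonempty (i : Fin N) : (G.pathsTo i).Nonempty := by
  induction i using G.induction_on_parents with
  | h0 i hi => simp [G.pathsTo_of_eq_zero hi]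
  | h1 i hi ih =>
    obtain ⟨j, hj⟩ := G.parents_nonempty hi
    obtain ⟨l, hl⟩ := ih j hj
    rw [G.pathsTo_of_ne_zero hi]
    exact ⟨_, Finset.mem_biUnion.2 ⟨j, hj, Finset.mem_image_of_mem _ hl⟩⟩

lemma paths_nonempty : G.paths.Nonempty := G.paths_eq_pathsTo_sink ▸ G.pathsTo_nonempty _

lemma pathScore_append {θ : Matrix (Fin N) (Fin N) ℝ} {i j : Fin N} {l : List (Fin N)}
    (hl : l ∈ G.pathsTo j) : pathScore θ (l ++ [i]) = pathScore θ l + θ i j :=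
  pathScore_append_singleton θ i j l ((G.mem_pathsTo j l).1 hl).2.1

lemma sum_pathsTo {i : Fin N} (hi : (i : ℕ) ≠ 0) (f : List (Fin N) → ℝ) :
    ∑ l ∈ G.pathsTo i, f l = ∑ j ∈ G.parents i, ∑ l ∈ G.pathsTo j, f (l ++ [i]) := by
  rw [G.pathsTo_of_ne_zero hi, Finset.sum_biUnion]
  · refine Finset.sum_congr rfl fun j _ => Finset.sum_image ?_
    intro l _ l' _ h
    exact List.append_cancel_right h
  · intro j _ j' _ hjj'
    refine Finset.disjoint_left.2 ?_
    simp only [Finset.mem_image]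
    rintro _ ⟨l, hl, rfl⟩ ⟨l', hl', h⟩
    obtain rfl := List.append_cancel_right h
    have h1 := ((G.mem_pathsTo j _).1 hl).2.1
    rw [((G.mem_pathsTo j' _).1 hl').2.1] at h1
    exact hjj' (Option.some.inj h1).symm

/-! ### Convexity and approximation bounds -/

lemma smoothValue_le_convexCombo {Ω : (Fin N → ℝ) → ℝ} {m : ℝ}
    (hm : ∀ q ∈ stdSimplex ℝ (Fin N), m ≤ Ω q) (θ θ' : Matrix (Fin N) (Fin N) ℝ) {a b : ℝ}
    (ha : 0 ≤ a) (hb : 0 ≤ b) (hab : a + b = 1) (i : Fin N) :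
    G.smoothValue Ω (a • θ + b • θ') i ≤
      a * G.smoothValue Ω θ i + b * G.smoothValue Ω θ' i := by
  induction i using G.induction_on_parents with
  | h0 i hi => simp [G.smoothValue_of_eq_zero _ _ hi]
  | h1 i hi ih =>
    simp only [G.smoothValue_of_ne_zero _ _ hi]
    refine smoothMaxOn_le_convexCombo (G.parents_nonempty hi) hm ha hb hab fun j hj => ?_
    have := ih j hj
    simp only [Matrix.add_apply, Matrix.smul_apply, smul_eq_mul]
    linarith

lemma convexOn_smoothDP {Ω : (Fin N → ℝ) → ℝ} (hΩ : ConvexOn ℝ (stdSimplex ℝ (Fin N)) Ω) :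
    ConvexOn ℝ Set.univ (fun θ : Matrix (Fin N) (Fin N) ℝ => G.smoothDP Ω θ) := by
  obtain ⟨m, hm⟩ := hΩ.exists_forall_le_stdSimplex
  exact ⟨convex_univ, fun θ _ θ' _ a b ha hb hab =>
    G.smoothValue_le_convexCombo hm θ θ' ha hb hab _⟩

/-- A path with between `1` and `i` edges accumulates a regularization of at most
`max U (i * U)`. -/
lemma pathScore_le_smoothValue_add {Ω : (Fin N → ℝ) → ℝ} {m U : ℝ}
    (hm : ∀ q ∈ stdSimplex ℝ (Fin N), m ≤ Ω q) (hU : ∀ q ∈ stdSimplex ℝ (Fin N), Ω q ≤ U)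
    (θ : Matrix (Fin N) (Fin N) ℝ) (i : Fin N) : ∀ l ∈ G.pathsTo i, pathScore θ l ≤
      G.smoothValue Ω θ i + if (i : ℕ) = 0 then 0 else max U (((i : ℕ) : ℝ) * U) := by
  induction i using G.induction_on_parents with
  | h0 i hi =>
    intro l hl
    obtain rfl : l = [i] := by simpa [G.pathsTo_of_eq_zero hi] using hl
    simp [pathScore, G.smoothValue_of_eq_zero _ _ hi, hi]
  | h1 i hi ih =>
    intro l hl
    simp only [G.pathsTo_of_ne_zero hi, Finset.mem_biUnion, Finset.mem_image] at hl
    obtain ⟨j, hj, l', hl', rfl⟩ := hl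
    have h1 := ih j hj l' hl'
    have h2 := sub_le_smoothMaxOn hm (fun j => θ i j + G.smoothValue Ω θ j) hj
    rw [← G.smoothValue_of_ne_zero _ _ hi] at h2
    have h3 := hU _ (single_mem_stdSimplex ℝ j)
    rw [G.pathScore_append hl', if_neg hi]
    have hji : ((j : ℕ) : ℝ) + 1 ≤ (i : ℕ) := by exact_mod_cast G.parent_lt i j hj
    suffices h : (if (j : ℕ) = 0 then (0 : ℝ) else max U (((j : ℕ) : ℝ) * U)) + U ≤
        max U (((i : ℕ) : ℝ) * U) by linarith
    split_ifs with hj0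
    · simp
    · rw [← max_add_add_right, max_le_iff]
      rcases le_total U 0 with hU0 | hU0
      · exact ⟨le_max_of_le_left (by linarith), le_max_of_le_left (by nlinarith)⟩
      · have : (1 : ℝ) ≤ (j : ℕ) := by exact_mod_cast Nat.one_le_iff_ne_zero.2 hj0
        exact ⟨le_max_of_le_right (by nlinarith), le_max_of_le_right (by nlinarith)⟩

lemma exists_smoothValue_add_le_pathScore {Ω : (Fin N → ℝ) → ℝ} {L : ℝ}
    (hL : ∀ q ∈ stdSimplex ℝ (Fin N), L ≤ Ω q) (θ : Matrix (Fin N) (Fin N) ℝ) (i : Fin N) :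
    ∃ l ∈ G.pathsTo i, G.smoothValue Ω θ i +
      (if (i : ℕ) = 0 then 0 else min L (((i : ℕ) : ℝ) * L)) ≤ pathScore θ l := by
  induction i using G.induction_on_parents with
  | h0 i hi =>
    exact ⟨[i], by simp [G.pathsTo_of_eq_zero hi],
      by simp [pathScore, G.smoothValue_of_eq_zero _ _ hi, hi]⟩
  | h1 i hi ih =>
    obtain ⟨j, hj, hmax⟩ := (G.parents i).exists_max_image
      (fun j => θ i j + G.smoothValue Ω θ j) (G.parents_nonempty hi)
    obtain ⟨l, hl, h1⟩ := ih j hj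
    refine ⟨l ++ [i], ?_, ?_⟩
    · rw [G.pathsTo_of_ne_zero hi]
      exact Finset.mem_biUnion.2 ⟨j, hj, Finset.mem_image_of_mem _ hl⟩
    have h2 := smoothMaxOn_le_sub (G.parents_nonempty hi) hL hmax
    rw [← G.smoothValue_of_ne_zero _ _ hi] at h2
    rw [G.pathScore_append hl, if_neg hi]
    have hji : ((j : ℕ) : ℝ) + 1 ≤ (i : ℕ) := by exact_mod_cast G.parent_lt i j hj
    suffices h : min L (((i : ℕ) : ℝ) * L) ≤
        (if (j : ℕ) = 0 then (0 : ℝ) else min L (((j : ℕ) : ℝ) * L)) + L by linarith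
    split_ifs with hj0
    · simp
    · rw [← min_add_add_right, le_min_iff]
      rcases le_total L 0 with hL0 | hL0
      · have : (1 : ℝ) ≤ (j : ℕ) := by exact_mod_cast Nat.one_le_iff_ne_zero.2 hj0
        exact ⟨min_le_of_right_le (by nlinarith), min_le_of_right_le (by nlinarith)⟩
      · exact ⟨min_le_of_left_le (by linarith), min_le_of_left_le (by nlinarith)⟩

lemma pathScore_le_LP (θ : Matrix (Fin N) (Fin N) ℝ) {l : List (Fin N)} (hl : l ∈ G.paths) :
    pathScore θ l ≤ G.LP θ :=
  le_ciSup (f := fun Y : G.paths => pathScore θ (Y : List (Fin N)))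
    (Set.finite_range _).bddAbove ⟨l, hl⟩

lemma LP_le {θ : Matrix (Fin N) (Fin N) ℝ} {K : ℝ} (h : ∀ l ∈ G.paths, pathScore θ l ≤ K) :
    G.LP θ ≤ K :=
  have : Nonempty G.paths := G.paths_nonempty.to_subtype
  ciSup_le fun Y => h Y.1 Y.2

lemma LP_sub_smoothDP_bounds {Ω : (Fin N → ℝ) → ℝ} {L U : ℝ}
    (h : ∀ q ∈ stdSimplex ℝ (Fin N), L ≤ Ω q ∧ Ω q ≤ U) (θ : Matrix (Fin N) (Fin N) ℝ) :
    min L (((N : ℝ) - 1) * L) ≤ G.LP θ - G.smoothDP Ω θ ∧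
      G.LP θ - G.smoothDP Ω θ ≤ max U (((N : ℝ) - 1) * U) := by
  have hN : (((G.sink : Fin N) : ℕ) : ℝ) = (N : ℝ) - 1 := by
    have := G.two_le
    simp only [sink]
    push_cast [show 1 ≤ N by omega]
    rfl
  constructor
  · obtain ⟨l, hl, h1⟩ := G.exists_smoothValue_add_le_pathScore (fun q hq => (h q hq).1) θ G.sink
    rw [if_neg G.sink_ne_zero, hN] at h1
    rw [← G.paths_eq_pathsTo_sink] at hl
    have h2 := G.pathScore_le_LP θ hl
    rw [smoothDP]
    linarith
  · have h1 := G.pathScore_le_smoothValue_add (fun q hq => (h q hq).1)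
      (fun q hq => (h q hq).2) θ G.sink
    rw [if_neg G.sink_ne_zero, hN, ← G.paths_eq_pathsTo_sink] at h1
    have h2 := G.LP_le h1
    rw [smoothDP]
    linarith

end TopoDAG

/-! ### The entropic case: log-sum-exp over paths -/

/-- The Gibbs variational principle: smoothing by negative entropy gives log-sum-exp. -/
lemma smoothMaxOn_eq_log_sum_exp {D : ℕ} {Ω : (Fin D → ℝ) → ℝ} {γ : ℝ} (hγ : 0 < γ)
    (hΩ : ∀ q ∈ stdSimplex ℝ (Fin D), Ω q = -γ * shannonEntropy q) {s : Finset (Fin D)}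
    (hs : s.Nonempty) (x : Fin D → ℝ) :
    smoothMaxOn Ω s x = γ * Real.log (∑ j ∈ s, Real.exp (x j / γ)) := by
  set Z := ∑ j ∈ s, Real.exp (x j / γ) with hZ
  have hZ0 : 0 < Z := Finset.sum_pos (fun j _ => Real.exp_pos _) hs
  -- The maximizer is the softmax distribution.
  set p : Fin D → ℝ := fun j => if j ∈ s then Real.exp (x j / γ) / Z else 0 with hp
  have hp0 : ∀ j, 0 ≤ p j := fun j => by
    simp only [hp]
    split_ifs <;> positivity
  have hp1 : ∑ j, p j = 1 := by
    simp only [hp, Finset.sum_ite_mem, Finset.univ_inter]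
    rw [← Finset.sum_div, div_self hZ0.ne']
  have hlog : ∀ j ∈ s, Real.log (p j) = x j / γ - Real.log Z := fun j hj => by
    simp only [hp, if_pos hj]
    rw [Real.log_div (Real.exp_pos _).ne' hZ0.ne', Real.log_exp]
  have hval : ∀ q ∈ stdSimplex ℝ (Fin D),
      ∑ j, q j * x j - Ω q = ∑ j, (q j * x j + γ * Real.negMulLog (q j)) := fun q hq => by
    rw [hΩ q hq, shannonEntropy, Finset.sum_add_distrib, ← Finset.mul_sum]
    ring
  have hub : ∀ q ∈ stdSimplex ℝ (Fin D), (∀ j, j ∉ s → q j = 0) →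
      ∑ j, q j * x j - Ω q ≤ γ * Real.log Z := by
    intro q hq hqs
    rw [hval q hq]
    calc ∑ j, (q j * x j + γ * Real.negMulLog (q j))
        ≤ ∑ j, γ * (q j * Real.log Z + (p j - q j)) := Finset.sum_le_sum fun j _ => ?_
      _ = γ * Real.log Z := by
        rw [← Finset.mul_sum, Finset.sum_add_distrib, Finset.sum_sub_distrib, hp1, hq.2,
          ← Finset.sum_mul, hq.2]
        ring
    rcases (hq.1 j).eq_or_lt with h0 | h0
    · simp only [← h0, Real.negMulLog_zero]
      have := mul_nonneg hγ.le (hp0 j)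
      simpa using this
    · have hj : j ∈ s := by
        by_contra hj
        exact h0.ne' (hqs j hj)
      have hpj : 0 < p j := by
        simp only [hp, if_pos hj]
        positivity
      have h1 := Real.log_le_sub_one_of_pos (div_pos hpj h0)
      rw [Real.log_div hpj.ne' h0.ne', hlog j hj] at h1
      have h2 := mul_le_mul_of_nonneg_left h1 (mul_pos hγ h0).le
      have h3 : γ * q j * (p j / q j - 1) = γ * (p j - q j) := by field_simp
      have h4 : γ * q j * (x j / γ) = q j * x j := by field_simp
      rw [h3] at h2
      rw [Real.negMulLog]
      linear_combination h2 - h4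
  refine le_antisymm (smoothMaxOn_le hs hub) (le_csSup ⟨γ * Real.log Z, ?_⟩ ⟨p, ⟨⟨hp0, hp1⟩,
    fun j hj => by simp [hp, hj]⟩, ?_⟩)
  · rintro _ ⟨q, ⟨hq, hqs⟩, rfl⟩
    exact hub q hq hqs
  · simp only
    rw [hval p ⟨hp0, hp1⟩]
    calc ∑ j, (p j * x j + γ * Real.negMulLog (p j)) = ∑ j, p j * (γ * Real.log Z) :=
          Finset.sum_congr rfl fun j _ => ?_
      _ = _ := by rw [← Finset.sum_mul, hp1, one_mul]
    by_cases hj : j ∈ s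
    · rw [Real.negMulLog, hlog j hj]
      field_simp
      ring
    · simp [hp, hj]

namespace TopoDAG

variable {N : ℕ} (G : TopoDAG N)

lemma smoothValue_eq_log_sum_exp {Ω : (Fin N → ℝ) → ℝ} {γ : ℝ} (hγ : 0 < γ)
    (hΩ : ∀ q ∈ stdSimplex ℝ (Fin N), Ω q = -γ * shannonEntropy q)
    (θ : Matrix (Fin N) (Fin N) ℝ) (i : Fin N) :
    G.smoothValue Ω θ i = γ * Real.log (∑ l ∈ G.pathsTo i, Real.exp (pathScore θ l / γ)) := by
  induction i using G.induction_on_parents with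
  | h0 i hi => simp [G.smoothValue_of_eq_zero _ _ hi, G.pathsTo_of_eq_zero hi, pathScore]
  | h1 i hi ih =>
    rw [G.smoothValue_of_ne_zero _ _ hi,
      smoothMaxOn_eq_log_sum_exp hγ hΩ (G.parents_nonempty hi), G.sum_pathsTo hi]
    congr 2
    refine Finset.sum_congr rfl fun j hj => ?_
    have hpos : 0 < ∑ l ∈ G.pathsTo j, Real.exp (pathScore θ l / γ) :=
      Finset.sum_pos (fun l _ => Real.exp_pos _) (G.pathsTo_nonempty j)
    rw [ih j hj, add_div, mul_div_cancel_left₀ _ hγ.ne', Real.exp_add, Real.exp_log hpos,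
      Finset.mul_sum]
    refine Finset.sum_congr rfl fun l hl => ?_
    rw [G.pathScore_append hl, add_div, Real.exp_add, mul_comm]

lemma univ_fin_card_paths_nonempty : (Finset.univ : Finset (Fin G.paths.card)).Nonempty :=
  ⟨⟨0, G.paths_nonempty.card_pos⟩, Finset.mem_univ _⟩

theorem smoothDP_eq_smoothLP_of_entropy {Ω : (D : ℕ) → (Fin D → ℝ) → ℝ} {γ : ℝ} (hγ : 0 ≤ γ)
    (hΩ : ∀ D, ∀ q ∈ stdSimplex ℝ (Fin D), Ω D q = -γ * shannonEntropy q)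
    (θ : Matrix (Fin N) (Fin N) ℝ) : G.smoothDP (Ω N) θ = G.smoothLP Ω θ := by
  rcases hγ.eq_or_lt with rfl | hγ
  · -- Without regularization, both sides are the maximum over all paths.
    have hΩ0 : ∀ D, ∀ q ∈ stdSimplex ℝ (Fin D), Ω D q = 0 := fun D q hq => by
      simp [hΩ D q hq]
    have h1 := G.LP_sub_smoothDP_bounds (L := 0) (U := 0)
      (fun q hq => ⟨(hΩ0 N q hq).ge, (hΩ0 N q hq).le⟩) θ
    simp only [mul_zero, min_self, max_self] at h1
    have h2 : G.smoothLP Ω θ = G.LP θ := by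
      refine le_antisymm ?_ (G.LP_le fun l hl => ?_)
      · have := smoothMaxOn_le_sub (m := 0) (K := G.LP θ) G.univ_fin_card_paths_nonempty
          (fun q hq => (hΩ0 _ q hq).ge)
          (x := fun k => pathScore θ (G.paths.equivFin.symm k : List (Fin N)))
          (fun k _ => G.pathScore_le_LP θ (G.paths.equivFin.symm k).2)
        simpa [smoothLP, smoothMax] using this
      · have := sub_le_smoothMaxOn (m := 0) (fun q hq => (hΩ0 _ q hq).ge)
          (fun k => pathScore θ (G.paths.equivFin.symm k : List (Fin N)))
          (Finset.mem_univ (G.paths.equivFin ⟨l, hl⟩))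
        rw [hΩ0 _ _ (single_mem_stdSimplex ℝ _)] at this
        simpa [smoothLP, smoothMax] using this
    rw [h2]
    linarith
  · rw [smoothDP, G.smoothValue_eq_log_sum_exp hγ (hΩ N), smoothLP, smoothMax,
      smoothMaxOn_eq_log_sum_exp hγ (hΩ _) G.univ_fin_card_paths_nonempty,
      ← G.paths_eq_pathsTo_sink]
    congr 2
    rw [Equiv.sum_comp G.paths.equivFin.symm (fun l => Real.exp (pathScore θ (l : List (Fin N)) / γ)),
      Finset.sum_coe_sort G.paths (fun l => Real.exp (pathScore θ l / γ))]

end TopoDAG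

/-! ### Recursive functions on the unit interval -/

/-- A function that is additive on the pairs with sum at most `1` is additive on finite sums. -/
lemma sum_map_eq_map_sum_of_additive {F : ℝ → ℝ}
    (hF : ∀ a b, 0 ≤ a → 0 ≤ b → a + b ≤ 1 → F (a + b) = F a + F b) {ι : Type*} (t : Finset ι)
    (q : ι → ℝ) (hq : ∀ i ∈ t, 0 ≤ q i) (hq1 : ∑ i ∈ t, q i ≤ 1) :
    ∑ i ∈ t, F (q i) = F (∑ i ∈ t, q i) := by
  classical
  induction t using Finset.induction_on with
  | empty =>
    have := hF 0 0 le_rfl le_rfl (by norm_num)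
    simp only [Finset.sum_empty, add_zero] at this ⊢
    linarith
  | insert i t hi ih =>
    rw [Finset.sum_insert hi] at hq1
    have h0 : 0 ≤ q i := hq i (Finset.mem_insert_self i t)
    have ht : ∀ j ∈ t, 0 ≤ q j := fun j hj => hq j (Finset.mem_insert_of_mem hj)
    rw [Finset.sum_insert hi, Finset.sum_insert hi, ih ht (by linarith),
      hF _ _ h0 (Finset.sum_nonneg ht) hq1]

/-- A nondecreasing completely additive arithmetic function is a multiple of the logarithm. -/
lemma exists_eq_mul_log_of_completelyAdditive {g : ℕ → ℝ}
    (hmul : ∀ m n, 1 ≤ m → 1 ≤ n → g (m * n) = g m + g n)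
    (hmono : ∀ n, 1 ≤ n → g n ≤ g (n + 1)) :
    ∃ γ : ℝ, 0 ≤ γ ∧ ∀ n : ℕ, 1 ≤ n → g n = γ * Real.log n := by
  have h1 : g 1 = 0 := by
    have := hmul 1 1 le_rfl le_rfl
    simp only [mul_one] at this
    linarith
  have hle : ∀ m n, 1 ≤ m → m ≤ n → g m ≤ g n := by
    intro m n hm hmn
    induction n, hmn using Nat.le_induction with
    | base => exact le_rfl
    | succ n hn ih => exact ih.trans (hmono n (hm.trans hn))
  have hpow : ∀ n, 1 ≤ n → ∀ k : ℕ, g (n ^ k) = k * g n := by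
    intro n hn k
    induction k with
    | zero => simp [h1]
    | succ k ih =>
      rw [pow_succ, hmul _ _ (Nat.one_le_pow _ _ hn) hn, ih]
      push_cast
      ring
  have hl2 : 0 < Real.log 2 := Real.log_pos (by norm_num)
  have h2 : 0 ≤ g 2 := h1 ▸ hle 1 2 le_rfl (by norm_num)
  refine ⟨g 2 / Real.log 2, div_nonneg h2 hl2.le, fun n hn => ?_⟩
  -- Comparing `n ^ m` with the neighbouring powers of `2` bounds `m` times the defect.
  have key : ∀ m : ℕ, |(m : ℝ) * (g n * Real.log 2 - g 2 * Real.log n)| ≤ g 2 * Real.log 2 := by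
    intro m
    have hnm : 1 ≤ n ^ m := Nat.one_le_pow _ _ hn
    set k := Nat.log 2 (n ^ m)
    have hk1 : 2 ^ k ≤ n ^ m := Nat.pow_log_le_self 2 (by omega)
    have hk2 : n ^ m ≤ 2 ^ (k + 1) := (Nat.lt_pow_succ_log_self (by norm_num) _).le
    have e1 := hle _ _ Nat.one_le_two_pow hk1
    have e2 := hle _ _ hnm hk2
    rw [hpow 2 (by norm_num), hpow n hn] at e1 e2
    have l1 : Real.log ((2 : ℝ) ^ k) ≤ Real.log ((n : ℝ) ^ m) :=
      Real.log_le_log (by positivity) (by exact_mod_cast hk1)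
    have l2 : Real.log ((n : ℝ) ^ m) ≤ Real.log ((2 : ℝ) ^ (k + 1)) :=
      Real.log_le_log (by exact_mod_cast hnm) (by exact_mod_cast hk2)
    rw [Real.log_pow, Real.log_pow] at l1 l2
    push_cast at e2 l2
    have a1 := mul_le_mul_of_nonneg_right e1 hl2.le
    have a2 := mul_le_mul_of_nonneg_right e2 hl2.le
    have a3 := mul_le_mul_of_nonneg_left l1 h2
    have a4 := mul_le_mul_of_nonneg_left l2 h2
    rw [abs_le]
    constructor <;> linarith
  have hzero : g n * Real.log 2 - g 2 * Real.log n = 0 := by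
    by_contra hne
    obtain ⟨m, hm⟩ := exists_nat_gt (g 2 * Real.log 2 / |g n * Real.log 2 - g 2 * Real.log n|)
    have := key m
    rw [abs_mul, Nat.abs_cast] at this
    rw [div_lt_iff₀ (abs_pos.2 hne)] at hm
    linarith
  field_simp
  linarith

/-- `ω` satisfies the grouping rule of entropy: splitting a mass `s` in the proportions `r` and
`1 - r` costs `s` times the binary value at `r`. -/
def IsRecursive (ω : ℝ → ℝ) : Prop :=
  ∀ s r, 0 ≤ s → s ≤ 1 → 0 ≤ r → r ≤ 1 →
    ω (s * r) + ω (s * (1 - r)) = ω s + s * (ω r + ω (1 - r))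

namespace IsRecursive

variable {ω : ℝ → ℝ}

lemma add_eq (h : IsRecursive ω) {a b : ℝ} (ha : 0 ≤ a) (hb : 0 ≤ b) (hab : a + b ≤ 1)
    (h0 : 0 < a + b) :
    ω a + ω b = ω (a + b) + (a + b) * (ω (a / (a + b)) + ω (b / (a + b))) := by
  have hr : 1 - a / (a + b) = b / (a + b) := by field_simp; ring
  have := h (a + b) (a / (a + b)) h0.le hab (by positivity) (by rw [div_le_one h0]; linarith)
  rwa [hr, mul_div_cancel₀ _ h0.ne', mul_div_cancel₀ _ h0.ne'] at this

/-- The defect of multiplicative scaling is additive. -/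
lemma additive_scaling (h : IsRecursive ω) (h0 : ω 0 = 0) {t : ℝ} (ht : 0 ≤ t) (ht1 : t ≤ 1)
    (a b : ℝ) (ha : 0 ≤ a) (hb : 0 ≤ b) (hab : a + b ≤ 1) :
    ω (t * (a + b)) - t * ω (a + b) = (ω (t * a) - t * ω a) + (ω (t * b) - t * ω b) := by
  rcases (add_nonneg ha hb).eq_or_lt with hs | hs
  · obtain rfl : a = 0 := by linarith
    obtain rfl : b = 0 := by linarith
    simp [h0]
  rcases ht.eq_or_lt with rfl | ht0
  · simp [h0]
  have e1 := h.add_eq ha hb hab hs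
  have hts : t * a + t * b = t * (a + b) := by ring
  have e2 := h.add_eq (mul_nonneg ht ha) (mul_nonneg ht hb)
    (by rw [hts]; exact mul_le_one₀ ht1 hs.le hab) (by rw [hts]; positivity)
  rw [hts, mul_div_mul_left _ _ ht0.ne', mul_div_mul_left _ _ ht0.ne'] at e2
  linear_combination t * e1 - e2

/-- The value at `t` in terms of a splitting of `t` into `k` equal parts. -/
lemma eq_of_equal_parts (h : IsRecursive ω) (h0 : ω 0 = 0) (h1 : ω 1 = 0) {t : ℝ} (ht : 0 ≤ t)
    (ht1 : t ≤ 1) {k : ℕ} (hk : 1 ≤ k) : ω t = k * ω (t / k) - t * (k * ω (1 / k)) := by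
  have hk0 : (k : ℝ) ≠ 0 := by positivity
  have hsum : ∑ _i ∈ Finset.range k, (1 / (k : ℝ)) = 1 := by
    simp [hk0]
  have := sum_map_eq_map_sum_of_additive (F := fun a => ω (t * a) - t * ω a)
    (h.additive_scaling h0 ht ht1) (Finset.range k) (fun _ => 1 / (k : ℝ))
    (fun _ _ => by positivity) hsum.le
  rw [hsum] at this
  simp only [Finset.sum_const, Finset.card_range, nsmul_eq_mul, mul_one, h1, mul_zero,
    sub_zero] at this
  rw [← this, mul_one_div]
  ring

/-- The binary values at rational points: `n * ω (1 / n)` is completely additive and antitone in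
`n`, hence a multiple of `log n`.  Only the binary values `ω p + ω (1 - p)` are determined: adding
to `ω` an additive function vanishing at `1` changes nothing. -/
lemma exists_log_rat (h : IsRecursive ω) (h0 : ω 0 = 0) (h1 : ω 1 = 0)
    (hanti : ∀ n : ℕ, 1 ≤ n → (n + 1 : ℝ) * ω (1 / (n + 1)) ≤ n * ω (1 / n)) :
    ∃ γ : ℝ, 0 ≤ γ ∧ ∀ k n : ℕ, 1 ≤ k → k < n →
      ω ((k : ℝ) / n) + ω (1 - (k : ℝ) / n) =
        -γ * (Real.negMulLog ((k : ℝ) / n) + Real.negMulLog (1 - (k : ℝ) / n)) := by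
  obtain ⟨γ, hγ, hlog⟩ := exists_eq_mul_log_of_completelyAdditive
    (g := fun n => -((n : ℝ) * ω (1 / n)))
    (fun m n hm hn => by
      have hm0 : (1 : ℝ) ≤ m := by exact_mod_cast hm
      have := h.eq_of_equal_parts h0 h1 (t := 1 / (m : ℝ)) (by positivity)
        (by rw [div_le_one (by linarith)]; exact hm0) hn
      rw [div_div] at this
      push_cast
      rw [this]
      field_simp
      ring)
    (fun n hn => by
      have := hanti n hn
      push_cast
      linarith)
  refine ⟨γ, hγ, fun k n hk hkn => ?_⟩
  have hn0 : (0 : ℝ) < n := by exact_mod_cast (by omega : 0 < n)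
  -- Splitting `k / n` into `k` parts of size `1 / n`.
  have hpart : ∀ j : ℕ, 1 ≤ j → j < n → ω ((j : ℝ) / n) =
      (j : ℝ) / n * (γ * (Real.log j - Real.log n)) := by
    intro j hj hjn
    have hj0 : (0 : ℝ) < j := by exact_mod_cast hj
    have hjn' : (j : ℝ) / n ≤ 1 := by
      rw [div_le_one hn0]
      exact_mod_cast hjn.le
    have e := h.eq_of_equal_parts h0 h1 (t := (j : ℝ) / n) (by positivity) hjn' hj
    have e1 := hlog j hj
    have e2 := hlog n (by omega)
    rw [div_div, mul_comm (n : ℝ) j, ← div_div, div_self hj0.ne'] at e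
    have e3 : ω (1 / n) = -(γ * Real.log n) / n := by
      rw [eq_div_iff hn0.ne']
      linarith
    rw [e, e3]
    have e4 : (j : ℝ) * ω (1 / j) = -(γ * Real.log j) := by linarith
    rw [e4]
    ring
  have hsub : 1 - (k : ℝ) / n = ((n - k : ℕ) : ℝ) / n := by
    rw [Nat.cast_sub hkn.le]
    field_simp
  have hk0 : (0 : ℝ) < k := by exact_mod_cast hk
  have hnk0 : (0 : ℝ) < ((n - k : ℕ) : ℝ) := by exact_mod_cast (by omega : 0 < n - k)
  rw [hsub, hpart k hk hkn, hpart (n - k) (by omega) (by omega), Real.negMulLog, Real.negMulLog,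
    Real.log_div hk0.ne' hn0.ne', Real.log_div hnk0.ne' hn0.ne']
  ring

/-- Two recursive functions that vanish at `0` and agree at `1` and in their binary values have the
same sum over each probability vector, although they may differ by an additive function. -/
lemma sum_eq_of_binary {η : ℝ → ℝ} (h : IsRecursive ω) (h' : IsRecursive η) (h0 : ω 0 = η 0)
    (h1 : ω 1 = η 1) (hω0 : ω 0 = 0)
    (hbin : ∀ p, 0 ≤ p → p ≤ 1 → ω p + ω (1 - p) = η p + η (1 - p)) {D : ℕ} {q : Fin D → ℝ}
    (hq : q ∈ stdSimplex ℝ (Fin D)) : ∑ i, ω (q i) = ∑ i, η (q i) := by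
  have hadd : ∀ a b, 0 ≤ a → 0 ≤ b → a + b ≤ 1 →
      ω (a + b) - η (a + b) = (ω a - η a) + (ω b - η b) := by
    intro a b ha hb hab
    rcases (add_nonneg ha hb).eq_or_lt with hs | hs
    · obtain rfl : a = 0 := by linarith
      obtain rfl : b = 0 := by linarith
      simp [← h0, hω0]
    have e1 := h.add_eq ha hb hab hs
    have e2 := h'.add_eq ha hb hab hs
    have e3 := hbin (a / (a + b)) (by positivity) (by rw [div_le_one hs]; linarith)
    rw [show 1 - a / (a + b) = b / (a + b) by field_simp; ring] at e3
    linear_combination e2 - e1 - (a + b) * e3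
  have := sum_map_eq_map_sum_of_additive (F := fun a => ω a - η a) hadd Finset.univ q
    (fun i _ => hq.1 i) hq.2.le
  rw [hq.2, Finset.sum_sub_distrib] at this
  linarith

end IsRecursive

lemma isRecursive_mul_negMulLog (γ : ℝ) : IsRecursive fun x => -γ * Real.negMulLog x := by
  intro s r _ _ _ _
  simp only [Real.negMulLog_mul]
  ring

/-! ### Biconjugation -/

section Biconjugation

variable {D : ℕ} {Ω : (Fin D → ℝ) → ℝ}

/-- A lower semicontinuous convex regularizer is the convex conjugate of its smoothed max. -/
lemma exists_smoothMax_le (hΩ : ConvexOn ℝ (stdSimplex ℝ (Fin D)) Ω)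
    (hlsc : LowerSemicontinuousOn Ω (stdSimplex ℝ (Fin D))) {p : Fin D → ℝ}
    (hp : p ∈ stdSimplex ℝ (Fin D)) {ε : ℝ} (hε : 0 < ε) :
    ∃ x : Fin D → ℝ, smoothMax Ω x ≤ ∑ j, p j * x j - Ω p + ε := by
  obtain ⟨l, c, hlc, hlp⟩ := hΩ.exists_affine_le_of_lt (𝕜 := ℝ) hp (sub_lt_self (Ω p) hε)
    (isClosed_stdSimplex ℝ (Fin D)) hlsc
  have hl : ∀ q : Fin D → ℝ, l q = ∑ j, q j * l (Pi.single j 1) := fun q => by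
    conv_lhs => rw [pi_eq_sum_univ' q]
    simp [map_sum]
  have hle : ∀ q ∈ stdSimplex ℝ (Fin D), l q + c ≤ Ω q := fun q hq => by
    simpa using hlc ⟨q, hq⟩
  have hp' : l p + c = Ω p - ε := by simpa using hlp
  have hne : (Finset.univ : Finset (Fin D)).Nonempty := by
    by_contra h
    rw [Finset.not_nonempty_iff_eq_empty] at h
    simpa [h] using hp.2
  refine ⟨fun j => l (Pi.single j 1), smoothMaxOn_le hne fun q hq _ => ?_⟩
  rw [← hl, ← hl]
  linarith [hle q hq]

lemma sum_mul_sub_le_smoothMax (hΩ : ConvexOn ℝ (stdSimplex ℝ (Fin D)) Ω) {q : Fin D → ℝ}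
    (hq : q ∈ stdSimplex ℝ (Fin D)) (x : Fin D → ℝ) : ∑ j, q j * x j - Ω q ≤ smoothMax Ω x := by
  obtain ⟨m, hm⟩ := hΩ.exists_forall_le_stdSimplex
  exact le_smoothMaxOn hm x hq (by simp)

lemma smoothMax_add_const_le (hΩ : ConvexOn ℝ (stdSimplex ℝ (Fin D)) Ω) (hD : 0 < D)
    (x : Fin D → ℝ) (k : ℝ) : smoothMax Ω (fun j => x j + k) ≤ smoothMax Ω x + k := by
  refine smoothMaxOn_le ⟨⟨0, hD⟩, Finset.mem_univ _⟩ fun q hq _ => ?_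
  have h1 := sum_mul_sub_le_smoothMax hΩ hq x
  have h2 : ∑ j, q j * (x j + k) = ∑ j, q j * x j + k := by
    simp only [mul_add, Finset.sum_add_distrib]
    rw [← Finset.sum_mul, hq.2, one_mul]
  linarith

end Biconjugation

/-- If the ternary smoothed max is an iterated binary one, the ternary regularizer satisfies the
grouping rule.  Both inequalities come from near-optimal vectors in the biconjugation formula, so
that neither convexity nor semicontinuity of the right-hand side has to be checked. -/
lemma grouping_of_smoothMax_assoc {Ω : (D : ℕ) → (Fin D → ℝ) → ℝ}
    (hΩ : ∀ D, ConvexOn ℝ (stdSimplex ℝ (Fin D)) (Ω D))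
    (hlsc : ∀ D, LowerSemicontinuousOn (Ω D) (stdSimplex ℝ (Fin D)))
    (hassoc : ∀ a b c, smoothMax (Ω 3) ![a, b, c] = smoothMax (Ω 2) ![a, smoothMax (Ω 2) ![b, c]])
    {s r : ℝ} (hs : 0 ≤ s) (hs1 : s ≤ 1) (hr : 0 ≤ r) (hr1 : r ≤ 1) :
    Ω 3 ![1 - s, s * r, s * (1 - r)] = Ω 2 ![1 - s, s] + s * Ω 2 ![r, 1 - r] := by
  have m2 : ∀ t : ℝ, 0 ≤ t → t ≤ 1 → ![t, 1 - t] ∈ stdSimplex ℝ (Fin 2) := fun t ht ht1 =>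
    ⟨by simp [Fin.forall_fin_two, ht, ht1], by simp⟩
  have hr2 := m2 r hr hr1
  have hs2 : ![1 - s, s] ∈ stdSimplex ℝ (Fin 2) := by
    simpa using m2 (1 - s) (by linarith) (by linarith)
  have h3 : ![1 - s, s * r, s * (1 - r)] ∈ stdSimplex ℝ (Fin 3) := by
    refine ⟨fun i => ?_, by simp [Fin.sum_univ_three]; ring⟩
    have h1 := mul_nonneg hs hr
    have h2 := mul_nonneg hs (sub_nonneg.2 hr1)
    fin_cases i
    · simpa using hs1
    · simpa using h1
    · simpa using h2
  refine le_antisymm (le_of_forall_pos_le_add fun ε hε => ?_)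
    (le_of_forall_pos_le_add fun ε hε => ?_)
  · obtain ⟨x, hx⟩ := exists_smoothMax_le (hΩ 3) (hlsc 3) h3 hε
    have hx' : x = ![x 0, x 1, x 2] := by ext i; fin_cases i <;> rfl
    rw [hx', hassoc] at hx
    have e1 := sum_mul_sub_le_smoothMax (hΩ 2) hr2 ![x 1, x 2]
    have e2 := sum_mul_sub_le_smoothMax (hΩ 2) hs2 ![x 0, smoothMax (Ω 2) ![x 1, x 2]]
    simp only [Fin.sum_univ_two, Fin.sum_univ_three, Matrix.cons_val_zero, Matrix.cons_val_one,
      Matrix.cons_val] at hx e1 e2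
    have e3 := mul_le_mul_of_nonneg_left e1 hs
    linarith
  · obtain ⟨y, hy⟩ := exists_smoothMax_le (hΩ 2) (hlsc 2) hr2 (half_pos hε)
    obtain ⟨x, hx⟩ := exists_smoothMax_le (hΩ 2) (hlsc 2) hs2 (half_pos hε)
    -- Translate the outer vector so that its second coordinate is the value of the inner max.
    set M := smoothMax (Ω 2) y with hM
    have hy' : ![y 0, y 1] = y := by ext i; fin_cases i <;> rfl
    have e1 := smoothMax_add_const_le (hΩ 2) (by norm_num) x (M - x 1)
    have hxk : (fun j => x j + (M - x 1)) = ![x 0 + (M - x 1), M] := by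
      ext i
      fin_cases i
      · rfl
      · simp
    have e2 := hassoc (x 0 + (M - x 1)) (y 0) (y 1)
    rw [show smoothMax (Ω 2) ![y 0, y 1] = M by rw [hy'], ← hxk] at e2
    have e3 := sum_mul_sub_le_smoothMax (hΩ 3) h3 ![x 0 + (M - x 1), y 0, y 1]
    simp only [Fin.sum_univ_two, Fin.sum_univ_three, Matrix.cons_val_zero, Matrix.cons_val_one,
      Matrix.cons_val] at hx hy e3
    have e4 := mul_le_mul_of_nonneg_left hy hs
    have e5 : s * (ε / 2) ≤ ε / 2 := by nlinarith
    linarith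

/-! ### Reindexing for separable regularizers -/

/-- For a separable regularizer the coordinates may be renumbered, and coordinates equal to `-∞`
may be dropped provided that `ω 0 = 0`. -/
lemma smoothMaxOn_image_eq {Ω : (D : ℕ) → (Fin D → ℝ) → ℝ} {ω : ℝ → ℝ}
    (hω : ∀ D, ∀ q ∈ stdSimplex ℝ (Fin D), Ω D q = ∑ i, ω (q i)) (h0 : ω 0 = 0) {D N : ℕ}
    {f : Fin D → Fin N} (hf : Function.Injective f) (x : Fin N → ℝ) :
    smoothMaxOn (Ω N) (Finset.univ.image f) x = smoothMax (Ω D) (x ∘ f) := by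
  have hsum : ∀ g : Fin N → ℝ, (∀ j, j ∉ Finset.univ.image f → g j = 0) →
      ∑ j, g j = ∑ k, g (f k) := fun g hg => by
    rw [← Finset.sum_image (g := f) (f := g) (s := Finset.univ) (fun a _ b _ h => hf h)]
    exact (Finset.sum_subset (Finset.subset_univ _) fun j _ hj => hg j hj).symm
  have hcomp : ∀ q : Fin N → ℝ, q ∈ stdSimplex ℝ (Fin N) →
      (∀ j, j ∉ Finset.univ.image f → q j = 0) → q ∘ f ∈ stdSimplex ℝ (Fin D) ∧
        ∑ k, (q ∘ f) k * (x ∘ f) k - Ω D (q ∘ f) = ∑ j, q j * x j - Ω N q := by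
    intro q hq hqs
    have hm : q ∘ f ∈ stdSimplex ℝ (Fin D) :=
      ⟨fun k => hq.1 _, by rw [← hq.2, hsum q hqs]; rfl⟩
    refine ⟨hm, ?_⟩
    rw [hω _ _ hm, hω _ _ hq, hsum (fun j => q j * x j) fun j hj => by simp [hqs j hj],
      hsum (fun j => ω (q j)) fun j hj => by simp [hqs j hj, h0]]
    rfl
  rw [smoothMax, smoothMaxOn, smoothMaxOn]
  congr 1
  ext v
  constructor
  · rintro ⟨q, ⟨hq, hqs⟩, rfl⟩
    exact ⟨q ∘ f, ⟨(hcomp q hq hqs).1, by simp⟩, (hcomp q hq hqs).2⟩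
  · rintro ⟨p, ⟨hp, -⟩, rfl⟩
    set q : Fin N → ℝ := Function.extend f p 0 with hqdef
    have hqf : q ∘ f = p := by
      ext k
      simp [hqdef, hf.extend_apply]
    have hqs : ∀ j, j ∉ Finset.univ.image f → q j = 0 := fun j hj => by
      rw [hqdef, Function.extend_apply' _ _ _ (by simpa using hj), Pi.zero_apply]
    have hq : q ∈ stdSimplex ℝ (Fin N) := by
      constructor
      · intro j
        by_cases hj : j ∈ Finset.univ.image f
        · obtain ⟨k, -, rfl⟩ := Finset.mem_image.1 hj
          rw [hqdef, hf.extend_apply]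
          exact hp.1 k
        · rw [hqs j hj]
      · rw [hsum q hqs, ← hp.2, ← hqf]
        rfl
    refine ⟨q, ⟨hq, hqs⟩, ?_⟩
    have := (hcomp q hq hqs).2
    rw [hqf] at this
    exact this.symm

namespace TopoDAG

/-- The smoothed maximum over the paths, for any enumeration of the paths. -/
lemma smoothLP_eq_smoothMax {Ω : (D : ℕ) → (Fin D → ℝ) → ℝ} {ω : ℝ → ℝ}
    (hω : ∀ D, ∀ q ∈ stdSimplex ℝ (Fin D), Ω D q = ∑ i, ω (q i)) (h0 : ω 0 = 0) {N D : ℕ}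
    (G : TopoDAG N) {f : Fin D → List (Fin N)} (hf : Function.Injective f)
    (hG : G.paths = Finset.univ.image f) (θ : Matrix (Fin N) (Fin N) ℝ) :
    G.smoothLP Ω θ = smoothMax (Ω D) (pathScore θ ∘ f) := by
  have hex : ∀ k, ∃ d, f d = (G.paths.equivFin.symm k : List (Fin N)) := fun k => by
    have := (Finset.ext_iff.1 hG _).1 (G.paths.equivFin.symm k).2
    simpa using this
  choose σ hσ using hex
  have hinj : Function.Injective σ := fun a b hab => by
    have := congrArg f hab
    rw [hσ, hσ] at this
    exact G.paths.equivFin.symm.injective (Subtype.ext this)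
  have huniv : Finset.univ.image σ = Finset.univ := by
    refine Finset.eq_univ_of_card _ ?_
    rw [Finset.card_image_of_injective _ hinj, Finset.card_univ, Fintype.card_fin, hG,
      Finset.card_image_of_injective _ hf, Finset.card_univ]
  rw [smoothMax, ← huniv, smoothMaxOn_image_eq hω h0 hinj, smoothLP]
  congr 1
  ext k
  simp [hσ]

lemma smoothLP_eq_of_paths_eq_singleton {Ω : (D : ℕ) → (Fin D → ℝ) → ℝ} {ω : ℝ → ℝ}
    (hω : ∀ D, ∀ q ∈ stdSimplex ℝ (Fin D), Ω D q = ∑ i, ω (q i)) {N : ℕ}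
    (G : TopoDAG N) {l : List (Fin N)} (hG : G.paths = {l}) (θ : Matrix (Fin N) (Fin N) ℝ) :
    G.smoothLP Ω θ = pathScore θ l - ω 1 := by
  have hcard : G.paths.card = 1 := by rw [hG, Finset.card_singleton]
  have hsub : Subsingleton (Fin G.paths.card) := by rw [hcard]; infer_instance
  set k : Fin G.paths.card := ⟨0, by omega⟩
  have huniv : (Finset.univ : Finset (Fin G.paths.card)) = {k} := by
    ext j
    simp [Subsingleton.elim j k]
  have hl : (G.paths.equivFin.symm k : List (Fin N)) = l := by
    have := (Finset.ext_iff.1 hG _).1 (G.paths.equivFin.symm k).2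
    simpa using this
  rw [smoothLP, smoothMax, huniv, smoothMaxOn_singleton, hl, hω _ _ (single_mem_stdSimplex ℝ k),
    huniv, Finset.sum_singleton, Pi.single_eq_same]

/-! ### The test graphs -/

/-- The graph with a single edge. -/
def singleEdge : TopoDAG 2 where
  parents := ![∅, {0}]
  two_le := le_rfl
  parent_lt := by decide
  parents_eq_empty_iff := by decide
  no_child_iff := by decide

/-- The graph that is a path with two edges. -/
def twoEdges : TopoDAG 3 where
  parents := ![∅, {0}, {1}]
  two_le := by norm_num
  parent_lt := by decide
  parents_eq_empty_iff := by decide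
  no_child_iff := by decide

/-- The graph on `0, 1, 2, 3` with the edges `0 → 1`, `0 → 2`, `1 → 2`, `0 → 3` and `2 → 3`: a
binary choice at the end node, one of whose options is another binary choice. -/
def nestedChoice : TopoDAG 4 where
  parents := ![∅, {0}, {0, 1}, {0, 2}]
  two_le := by norm_num
  parent_lt := by decide
  parents_eq_empty_iff := by decide
  no_child_iff := by decide

lemma paths_singleEdge : singleEdge.paths = {[0, 1]} := by
  rw [paths_eq_pathsTo_sink, show singleEdge.sink = 1 from rfl,
    pathsTo_of_ne_zero _ (by decide), show singleEdge.parents 1 = {0} from rfl,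
    Finset.singleton_biUnion, pathsTo_of_eq_zero _ rfl]
  rfl

lemma paths_twoEdges : twoEdges.paths = {[0, 1, 2]} := by
  rw [paths_eq_pathsTo_sink, show twoEdges.sink = 2 from rfl,
    pathsTo_of_ne_zero _ (by decide), show twoEdges.parents 2 = {1} from rfl,
    Finset.singleton_biUnion, pathsTo_of_ne_zero _ (by decide),
    show twoEdges.parents 1 = {0} from rfl, Finset.singleton_biUnion, pathsTo_of_eq_zero _ rfl]
  rfl

lemma paths_nestedChoice :
    nestedChoice.paths = Finset.univ.image ![[0, 3], [0, 2, 3], [0, 1, 2, 3]] := by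
  have h0 : nestedChoice.pathsTo 0 = {[0]} := pathsTo_of_eq_zero _ rfl
  have h1 : nestedChoice.pathsTo 1 = {[0, 1]} := by
    rw [pathsTo_of_ne_zero _ (by decide), show nestedChoice.parents 1 = {0} from rfl,
      Finset.singleton_biUnion, h0]
    rfl
  have h2 : nestedChoice.pathsTo 2 = {[0, 2], [0, 1, 2]} := by
    rw [pathsTo_of_ne_zero _ (by decide), show nestedChoice.parents 2 = {0, 1} from rfl,
      Finset.biUnion_insert, Finset.singleton_biUnion, h0, h1]
    decide
  rw [paths_eq_pathsTo_sink, show nestedChoice.sink = 3 from rfl,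
    pathsTo_of_ne_zero _ (by decide), show nestedChoice.parents 3 = {0, 2} from rfl,
    Finset.biUnion_insert, Finset.singleton_biUnion, h0, h2]
  decide

lemma smoothValue_of_parents_eq_singleton {N : ℕ} (G : TopoDAG N) (Ω : (Fin N → ℝ) → ℝ)
    (θ : Matrix (Fin N) (Fin N) ℝ) {i j : Fin N} (h : G.parents i = {j}) :
    G.smoothValue Ω θ i = θ i j + G.smoothValue Ω θ j - Ω (Pi.single j 1) := by
  rw [G.smoothValue_of_ne_zero Ω θ (G.ne_zero_of_mem_parents (h ▸ Finset.mem_singleton_self j)),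
    h, smoothMaxOn_singleton]

section Agreement

variable {Ω : (D : ℕ) → (Fin D → ℝ) → ℝ} {ω : ℝ → ℝ}

lemma endpoints_eq_zero (hω : ∀ D, ∀ q ∈ stdSimplex ℝ (Fin D), Ω D q = ∑ i, ω (q i))
    (hDP : ∀ (N : ℕ) (G : TopoDAG N) (θ : Matrix (Fin N) (Fin N) ℝ),
      G.smoothDP (Ω N) θ = G.smoothLP Ω θ) : ω 0 = 0 ∧ ω 1 = 0 := by
  have h2 := hDP 2 singleEdge 0
  rw [smoothLP_eq_of_paths_eq_singleton hω _ paths_singleEdge, smoothDP,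
    show singleEdge.sink = 1 from rfl, smoothValue_of_parents_eq_singleton _ _ _ (j := 0) rfl,
    smoothValue_of_eq_zero _ _ _ rfl, hω _ _ (single_mem_stdSimplex ℝ _)] at h2
  simp [pathScore] at h2
  have h3 := hDP 3 twoEdges 0
  rw [smoothLP_eq_of_paths_eq_singleton hω _ paths_twoEdges, smoothDP,
    show twoEdges.sink = 2 from rfl, smoothValue_of_parents_eq_singleton _ _ _ (j := 1) rfl,
    smoothValue_of_parents_eq_singleton _ _ _ (j := 0) rfl,
    smoothValue_of_eq_zero _ _ _ rfl, hω _ _ (single_mem_stdSimplex ℝ _),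
    hω _ _ (single_mem_stdSimplex ℝ _)] at h3
  simp [pathScore, Fin.sum_univ_three, Pi.single_apply] at h3
  constructor <;> linarith

lemma smoothMax_assoc (hω : ∀ D, ∀ q ∈ stdSimplex ℝ (Fin D), Ω D q = ∑ i, ω (q i))
    (hDP : ∀ (N : ℕ) (G : TopoDAG N) (θ : Matrix (Fin N) (Fin N) ℝ),
      G.smoothDP (Ω N) θ = G.smoothLP Ω θ) (a b c : ℝ) :
    smoothMax (Ω 3) ![a, b, c] = smoothMax (Ω 2) ![a, smoothMax (Ω 2) ![b, c]] := by
  obtain ⟨h0, h1⟩ := endpoints_eq_zero hω hDP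
  obtain ⟨θ, t10, t20, t21, t30, t32⟩ : ∃ θ : Matrix (Fin 4) (Fin 4) ℝ,
      θ 1 0 = 0 ∧ θ 2 0 = b ∧ θ 2 1 = c ∧ θ 3 0 = a ∧ θ 3 2 = 0 :=
    ⟨!![0, 0, 0, 0; 0, 0, 0, 0; b, c, 0, 0; a, 0, 0, 0], by simp⟩
  have e := hDP 4 nestedChoice θ
  rw [smoothLP_eq_smoothMax hω h0 _ (by decide) paths_nestedChoice] at e
  have hscore : pathScore θ ∘ ![[0, 3], [0, 2, 3], [0, 1, 2, 3]] = ![a, b, c] := by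
    ext i
    fin_cases i <;> simp [pathScore, t10, t20, t21, t30, t32]
  have v0 : nestedChoice.smoothValue (Ω 4) θ 0 = 0 := smoothValue_of_eq_zero _ _ _ rfl
  have v1 : nestedChoice.smoothValue (Ω 4) θ 1 = 0 := by
    rw [smoothValue_of_parents_eq_singleton _ _ _ (j := 0) rfl, v0,
      hω _ _ (single_mem_stdSimplex ℝ _)]
    simp [Fin.sum_univ_four, Pi.single_apply, h0, h1, t10]
  have v2 : nestedChoice.smoothValue (Ω 4) θ 2 = smoothMax (Ω 2) ![b, c] := by
    rw [smoothValue_of_ne_zero _ _ _ (by decide),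
      show nestedChoice.parents 2 = Finset.univ.image ![0, 1] by decide,
      smoothMaxOn_image_eq hω h0 (by decide)]
    congr 1
    ext i
    fin_cases i <;> simp [v0, v1, t20, t21]
  have v3 : nestedChoice.smoothDP (Ω 4) θ = smoothMax (Ω 2) ![a, smoothMax (Ω 2) ![b, c]] := by
    rw [smoothDP, show nestedChoice.sink = 3 from rfl, smoothValue_of_ne_zero _ _ _ (by decide),
      show nestedChoice.parents 3 = Finset.univ.image ![0, 2] by decide,
      smoothMaxOn_image_eq hω h0 (by decide)]
    congr 1
    ext i
    fin_cases i <;> simp [v0, v2, t30, t32]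
  rw [← hscore, ← e, v3]

end Agreement

end TopoDAG

/-! ### Agreement of the two programs forces the entropy -/

section Characterization

variable {Ω : (D : ℕ) → (Fin D → ℝ) → ℝ} {ω : ℝ → ℝ}

lemma isRecursive_of_smoothDP_eq_smoothLP
    (hΩ : ∀ D, ConvexOn ℝ (stdSimplex ℝ (Fin D)) (Ω D))
    (hlsc : ∀ D, LowerSemicontinuousOn (Ω D) (stdSimplex ℝ (Fin D)))
    (hω : ∀ D, ∀ q ∈ stdSimplex ℝ (Fin D), Ω D q = ∑ i, ω (q i))
    (hDP : ∀ (N : ℕ) (G : TopoDAG N) (θ : Matrix (Fin N) (Fin N) ℝ),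
      G.smoothDP (Ω N) θ = G.smoothLP Ω θ) : IsRecursive ω := by
  intro s r hs hs1 hr hr1
  have key := grouping_of_smoothMax_assoc hΩ hlsc (TopoDAG.smoothMax_assoc hω hDP) hs hs1 hr hr1
  have h1 := mul_nonneg hs hr
  have h2 := mul_nonneg hs (sub_nonneg.2 hr1)
  rw [hω 3 _ ⟨fun i => by fin_cases i <;> simp [hs1, h1, h2],
      by simp [Fin.sum_univ_three]; ring⟩,
    hω 2 _ ⟨fun i => by fin_cases i <;> simp [hs, hs1], by simp⟩,
    hω 2 _ ⟨fun i => by fin_cases i <;> simp [hr, hr1], by simp⟩] at key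
  simp only [Fin.sum_univ_two, Fin.sum_univ_three, Matrix.cons_val_zero, Matrix.cons_val_one,
    Matrix.cons_val] at key
  linarith

/-- Jensen's inequality: the uniform vector on `n + 1` points is the mean of the vectors that are
uniform on `n` of them. -/
lemma uniform_antitone (hΩ : ∀ D, ConvexOn ℝ (stdSimplex ℝ (Fin D)) (Ω D))
    (hω : ∀ D, ∀ q ∈ stdSimplex ℝ (Fin D), Ω D q = ∑ i, ω (q i)) (h0 : ω 0 = 0) (n : ℕ)
    (hn : 1 ≤ n) : (n + 1 : ℝ) * ω (1 / (n + 1)) ≤ n * ω (1 / n) := by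
  have hn0 : (0 : ℝ) < n := by exact_mod_cast hn
  set p : Fin (n + 1) → Fin (n + 1) → ℝ := fun i j => if j = i then 0 else 1 / n with hp
  have hsum : ∀ (i : Fin (n + 1)) (u v : ℝ), ∑ j, (if j = i then u else v) = u + n * v := by
    intro i u v
    rw [← Finset.add_sum_erase _ _ (Finset.mem_univ i), if_pos rfl,
      Finset.sum_congr rfl (g := fun _ => v) fun j hj => if_neg (Finset.ne_of_mem_erase hj)]
    simp
  have hpmem : ∀ i, p i ∈ stdSimplex ℝ (Fin (n + 1)) := fun i =>
    ⟨fun j => by simp only [hp]; split_ifs <;> positivity, by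
      simp only [hp, hsum]
      field_simp
      ring⟩
  have hpval : ∀ i, Ω (n + 1) (p i) = n * ω (1 / n) := fun i => by
    rw [hω _ _ (hpmem i)]
    simp only [hp, apply_ite ω, hsum, h0, zero_add]
  have hJ := (hΩ (n + 1)).map_sum_le (t := Finset.univ) (w := fun _ => 1 / ((n : ℝ) + 1)) (p := p)
    (fun _ _ => by positivity) (by simp; field_simp) (fun i _ => hpmem i)
  have hmean : ∑ i, (1 / ((n : ℝ) + 1)) • p i = fun _ => 1 / ((n : ℝ) + 1) := by
    ext j
    simp only [Finset.sum_apply, Pi.smul_apply, smul_eq_mul, hp, eq_comm (a := j)]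
    rw [← Finset.mul_sum, hsum]
    field_simp
    ring
  have hmem : (fun _ => 1 / ((n : ℝ) + 1)) ∈ stdSimplex ℝ (Fin (n + 1)) :=
    ⟨fun _ => by positivity, by simp; field_simp⟩
  rw [hmean, hω _ _ hmem] at hJ
  simp only [hpval, Finset.sum_const, Finset.card_univ, Fintype.card_fin, nsmul_eq_mul,
    smul_eq_mul] at hJ
  push_cast at hJ
  refine hJ.trans_eq ?_
  field_simp

/-- Convexity makes the binary values continuous, so that they are determined by the rationals. -/
lemma binary_eq_of_rat (hΩ : ConvexOn ℝ (stdSimplex ℝ (Fin 2)) (Ω 2))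
    (hω : ∀ D, ∀ q ∈ stdSimplex ℝ (Fin D), Ω D q = ∑ i, ω (q i)) {η : ℝ → ℝ}
    (hη : Continuous η) (hrat : ∀ k n : ℕ, 1 ≤ k → k < n →
      ω ((k : ℝ) / n) + ω (1 - (k : ℝ) / n) = η ((k : ℝ) / n)) :
    ∀ p ∈ Set.Ioo (0 : ℝ) 1, ω p + ω (1 - p) = η p := by
  have hconv : ConvexOn ℝ (Set.Ioo (0 : ℝ) 1) fun p => ω p + ω (1 - p) := by
    have hmem : ∀ p ∈ Set.Ioo (0 : ℝ) 1, ![p, 1 - p] ∈ stdSimplex ℝ (Fin 2) := fun p hp =>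
      ⟨fun i => by fin_cases i <;> simp [hp.1.le, hp.2.le], by simp⟩
    have hval : ∀ p ∈ Set.Ioo (0 : ℝ) 1, Ω 2 ![p, 1 - p] = ω p + ω (1 - p) := fun p hp => by
      rw [hω 2 _ (hmem p hp)]
      simp
    refine ⟨convex_Ioo 0 1, fun x hx y hy a b ha hb hab => ?_⟩
    have h := hΩ.2 (hmem x hx) (hmem y hy) ha hb hab
    have hcomb : a • ![x, 1 - x] + b • ![y, 1 - y] =
        ![a • x + b • y, 1 - (a • x + b • y)] := by
      ext i
      fin_cases i
      · simp
      · simp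
        linear_combination hab
    rwa [hcomb, hval _ (convex_Ioo 0 1 hx hy ha hb hab), hval x hx, hval y hy] at h
  have hcl : Set.Ioo (0 : ℝ) 1 ⊆ closure (Set.Ioo (0 : ℝ) 1 ∩ Set.range ((↑) : ℚ → ℝ)) :=
    Dense.open_subset_closure_inter Rat.denseRange_cast isOpen_Ioo
  refine Set.EqOn.of_subset_closure (s := Set.Ioo (0 : ℝ) 1 ∩ Set.range ((↑) : ℚ → ℝ))
    ?_ (hconv.continuousOn isOpen_Ioo) hη.continuousOn Set.inter_subset_left hcl
  rintro _ ⟨hp, x, rfl⟩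
  have hx0 : 0 < x := by exact_mod_cast hp.1
  have hx1 : x < 1 := by exact_mod_cast hp.2
  have hnum : 0 < x.num := Rat.num_pos.2 hx0
  have hcast : ((x.num.toNat : ℕ) : ℝ) = (x.num : ℝ) := by
    exact_mod_cast Int.toNat_of_nonneg hnum.le
  have hx : (x : ℝ) = (x.num.toNat : ℝ) / (x.den : ℝ) := by
    rw [hcast]
    exact Rat.cast_def x
  have hlt : x.num < x.den := Rat.num_lt_denom_iff.2 hx1
  rw [hx]
  exact hrat _ _ (by omega) (by omega)

theorem exists_eq_entropy_of_smoothDP_eq_smoothLP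
    (hΩ : ∀ D, ConvexOn ℝ (stdSimplex ℝ (Fin D)) (Ω D))
    (hlsc : ∀ D, LowerSemicontinuousOn (Ω D) (stdSimplex ℝ (Fin D)))
    (hω : ∀ D, ∀ q ∈ stdSimplex ℝ (Fin D), Ω D q = ∑ i, ω (q i))
    (hDP : ∀ (N : ℕ) (G : TopoDAG N) (θ : Matrix (Fin N) (Fin N) ℝ),
      G.smoothDP (Ω N) θ = G.smoothLP Ω θ) :
    ∃ γ : ℝ, 0 ≤ γ ∧ ∀ D, ∀ q ∈ stdSimplex ℝ (Fin D), Ω D q = -γ * shannonEntropy q := by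
  obtain ⟨h0, h1⟩ := TopoDAG.endpoints_eq_zero hω hDP
  have hrec := isRecursive_of_smoothDP_eq_smoothLP hΩ hlsc hω hDP
  obtain ⟨γ, hγ, hrat⟩ := hrec.exists_log_rat h0 h1 (uniform_antitone hΩ hω h0)
  have hbin := binary_eq_of_rat (hΩ 2) hω
    (η := fun p => -γ * (Real.negMulLog p + Real.negMulLog (1 - p))) (by fun_prop) hrat
  refine ⟨γ, hγ, fun D q hq => ?_⟩
  rw [hω D q hq, shannonEntropy, Finset.mul_sum]
  refine hrec.sum_eq_of_binary (isRecursive_mul_negMulLog γ) (by simp [h0]) (by simp [h1]) h0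
    (fun p hp hp1 => ?_) hq
  rcases hp.eq_or_lt with rfl | hp
  · simp [h0, h1]
  rcases hp1.eq_or_lt with rfl | hp1
  · simp [h0, h1]
  rw [hbin p ⟨hp, hp1⟩]
  ring

end Characterization

theorem mainTheorem1 (Ω : (D : ℕ) → (Fin D → ℝ) → ℝ)
    (hΩ : ∀ D, ConvexOn ℝ (stdSimplex ℝ (Fin D)) (Ω D)) :
    (∀ (N : ℕ) (G : TopoDAG N),
      ConvexOn ℝ Set.univ (fun θ : Matrix (Fin N) (Fin N) ℝ => G.smoothDP (Ω N) θ)) ∧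
    (∀ (N : ℕ) (G : TopoDAG N) (L U : ℝ),
      (∀ q ∈ stdSimplex ℝ (Fin N), L ≤ Ω N q ∧ Ω N q ≤ U) →
      ∀ θ : Matrix (Fin N) (Fin N) ℝ,
        min L (((N : ℝ) - 1) * L) ≤ G.LP θ - G.smoothDP (Ω N) θ ∧
        G.LP θ - G.smoothDP (Ω N) θ ≤ max U (((N : ℝ) - 1) * U)) ∧
    ((∀ D, LowerSemicontinuousOn (Ω D) (stdSimplex ℝ (Fin D))) → IsSeparableRegularizer Ω →
      ((∀ (N : ℕ) (G : TopoDAG N) (θ : Matrix (Fin N) (Fin N) ℝ),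
          G.smoothDP (Ω N) θ = G.smoothLP Ω θ) ↔
        ∃ γ : ℝ, 0 ≤ γ ∧ ∀ D, ∀ q ∈ stdSimplex ℝ (Fin D),
          Ω D q = -γ * shannonEntropy q)) := by
  refine ⟨fun N G => G.convexOn_smoothDP (hΩ N),
    fun N G L U h θ => G.LP_sub_smoothDP_bounds h θ, fun hlsc ⟨ω, hω⟩ => ⟨fun hDP =>
      exists_eq_entropy_of_smoothDP_eq_smoothLP hΩ hlsc hω hDP, ?_⟩⟩
  rintro ⟨γ, hγ, hent⟩ N G θ
  exact G.smoothDP_eq_smoothLP_of_entropy hγ hent θ
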